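/- Let $f$ be a holomorphic function in a neighbourhood of $0\in\mathbb{C}^3$ with Taylor expansion $\sum_{\nu\in\mathbb{N}^3} a_\nu z^\nu$ at $0$. Its Newton diagram is $\Gamma_+(f):=\operatorname{conv}\bigcup_{a_\nu\neq 0}(\nu+\mathbb{R}_+^3)$, where $\mathbb{R}_+=[0,\infty)$. A face of $\Gamma_+(f)$ is a set of the form $\{v\in\Gamma_+(f):\langle u,v\rangle=\inf_{w\in\Gamma_+(f)}\langle u,w\rangle\}$ with $u\in\mathbb{R}_+^3\setminus\{0\}$, and $\Gamma^k(f)$ denotes the set of all compact $k$-dimensional faces of $\Gamma_+(f)$. Let $\mathcal{J}$ be the family of all segments $I_1^k=\overline{(0,1,1)(k,0,0)}$, $I_2^k=\overline{(1,0,1)(0,k,0)}$, $I_3^k=\overline{(1,1,0)(0,0,k)}$ in $\mathbb{R}^3$ with $k\in\{2,3,\ldots\}$. Suppose that $f$ is an isolated singularity, i.e. $f$ is not identically zero near $0$, $f(0)=0$, $\nabla f(0)=0$, and $\nabla f(z)\neq 0$ for all $z\neq 0$ sufficiently close to $0$. If $\Gamma^2(f)=\emptyset$, then there exists $I\in\mathcal{J}$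 such that $\Gamma^1(f)=\{I\}$. -/

import Mathlib

open Filter Topology

noncomputable section

/-- The gradient `(∂f/∂z₁, …, ∂f/∂zₙ)` of `f : ℂⁿ → ℂ` at the point `z`. -/
def complexGradient {n : ℕ} (f : (Fin n → ℂ) → ℂ) (z : Fin n → ℂ) : Fin n → ℂ :=
  fun i => fderiv ℂ f z (Pi.single i 1)

/-- `f` is a singularity: a nonzero germ at `0` of a holomorphic function with `f(0) = 0` and
`∇f(0) = 0`. -/
structure IsSingularity {n : ℕ} (f : (Fin n → ℂ) → ℂ) : Prop where
  holomorphic : AnalyticAt ℂ f 0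
  ne_zero : ¬ (∀ᶠ z in 𝓝 (0 : Fin n → ℂ), f z = 0)
  map_zero : f 0 = 0
  gradient_zero : complexGradient f 0 = 0

/-- `f` is an isolated singularity: a singularity whose gradient has no zero `z ≠ 0` near `0`. -/
structure IsIsolatedSingularity {n : ℕ} (f : (Fin n → ℂ) → ℂ) : Prop
    extends IsSingularity f where
  isolated : ∀ᶠ z in 𝓝[≠] (0 : Fin n → ℂ), complexGradient f z ≠ 0

/-- The coefficient `a_ν = (∂^ν f)(0) / ν!` of `z^ν` in the Taylor expansion of `f` at `0`.
The derivative of order `|ν| = ν₁ + ⋯ + νₙ` is evaluated at the list of directions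
`e₁, …, e₁, e₂, …, e₂, …, eₙ, …, eₙ` in which `eᵢ` occurs `νᵢ` times. -/
def taylorCoeff {n : ℕ} (f : (Fin n → ℂ) → ℂ) (ν : Fin n → ℕ) : ℂ :=
  iteratedFDeriv ℂ (∑ i, ν i) f 0
    (fun j => Pi.single (finSigmaFinEquiv.symm j).1 (1 : ℂ)) / ((∏ i, (ν i).factorial : ℕ) : ℂ)

/-- The Newton diagram `Γ₊(f)`: the convex hull of the union of the sets `ν + ℝⁿ₊` over all `ν`
with `a_ν ≠ 0`. -/
def newtonDiagram {n : ℕ} (f : (Fin n → ℂ) → ℂ) : Set (Fin n → ℝ) :=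
  convexHull ℝ {x | ∃ ν : Fin n → ℕ, taylorCoeff f ν ≠ 0 ∧ ∀ i, (ν i : ℝ) ≤ x i}

/-- `l(u, A) = inf {⟨u, v⟩ : v ∈ A}`. -/
def supportValue {n : ℕ} (u : Fin n → ℝ) (A : Set (Fin n → ℝ)) : ℝ :=
  sInf ((fun v => ∑ i, u i * v i) '' A)

/-- `Δ(u, A) = {v ∈ A : ⟨u, v⟩ = l(u, A)}`. -/
def supportFace {n : ℕ} (u : Fin n → ℝ) (A : Set (Fin n → ℝ)) : Set (Fin n → ℝ) :=
  {v | v ∈ A ∧ ∑ i, u i * v i = supportValue u A}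

/-- The Newton boundary `Γ(f)`: the family of all compact faces of the Newton diagram, a face being
a set `Δ(u, Γ₊(f))` with `u ∈ ℝⁿ₊ \ {0}`. -/
def newtonBoundary {n : ℕ} (f : (Fin n → ℂ) → ℂ) : Set (Set (Fin n → ℝ)) :=
  {S | IsCompact S ∧
    ∃ u : Fin n → ℝ, (∀ i, 0 ≤ u i) ∧ u ≠ 0 ∧ S = supportFace u (newtonDiagram f)}

/-- `Γᵏ(f)`: the set of all compact faces of dimension `k`, the dimension of a face being that of
its affine hull. -/
def newtonFaces {n : ℕ} (f : (Fin n → ℂ) → ℂ) (k : ℕ) : Set (Set (Fin n → ℝ)) :=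
  {S | S ∈ newtonBoundary f ∧ Module.finrank ℝ (vectorSpan ℝ S) = k}

/-- The family of segments `I_j^k` in `ℝ³`, `j = 1, 2, 3`, `k = 2, 3, …`, where `I_j^k` joins the
point whose `j`-th coordinate is `0` and whose other two are `1` to the point `k` on the
`j`-th axis. -/
def segmentFamilyJ : Set (Set (Fin 3 → ℝ)) :=
  {I | ∃ (j : Fin 3) (k : ℕ), 2 ≤ k ∧
    I = segment ℝ (fun i => if i = j then (0 : ℝ) else 1) (Pi.single j (k : ℝ))}

end

/-! Only three facts about the Taylor support are needed (`IsIsolatedSupport`). Exponents have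
degree at least 2. For each `i` there is a monomial `z_i ^ a * z_j`, else the gradient would vanish
along the `i`-th axis. Each coordinate plane meets the support, else f = z_i g and the gradient
would vanish at the zeros of g on z_i = 0, which are not isolated at 0. The rest is combinatorics.

Without compact 2-faces, the minimal exponents of a positive weight u are collinear. Hence a
nonnegative functional v constant on an edge attains its minimum over the support on that edge
(`le_of_exponentWeight_eq`): otherwise, tilting u towards v until a further exponent becomes minimal
produces a triangle. Testing well-chosen v on the axis and plane exponents determines the ends of an
edge (`exists_eq_single`); testing on another edge shows that there is only one (`index_eq_and_eq`).
An edge exists because tilting (1,1,1) towards a coordinate that is nonzero on a minimal exponent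
must bring in a second one (`exists_minimalExponents_ne`). -/

/-! ### Taylor terms and zeros of analytic functions. -/

/-- The iterated derivative at `0` along unit vectors `e_{r 0}, e_{r 1}, …` vanishes when the Taylor
coefficient of the multi-index counting the values of `r` does. -/
theorem iteratedFDeriv_single_eq_zero {n : ℕ} {f : (Fin n → ℂ) → ℂ} (hf : AnalyticAt ℂ f 0)
    {m : ℕ} (r : Fin m → Fin n) (ν : Fin n → ℕ)
    (hν : ∀ i, ν i = Fintype.card {k // r k = i}) (h : taylorCoeff f ν = 0) :
    iteratedFDeriv ℂ m f 0 (fun k => Pi.single (r k) (1 : ℂ)) = 0 := by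
  have hm : m = ∑ i, ν i := by
    simp_rw [hν]
    rw [← Fintype.card_sigma, Fintype.card_congr (Equiv.sigmaFiberEquiv r), Fintype.card_fin]
  subst hm
  -- The derivative is symmetric, so `r` may be sorted: `σ` matches the blocks of directions in
  -- `taylorCoeff` with the fibres of `r`.
  let e : (Σ i, Fin (ν i)) ≃ Σ i, {k // r k = i} :=
    Equiv.sigmaCongrRight fun i => (Fintype.equivFinOfCardEq (hν i).symm).symm
  let σ : Equiv.Perm (Fin (∑ i, ν i)) :=
    finSigmaFinEquiv.symm.trans (e.trans (Equiv.sigmaFiberEquiv r))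
  have hσ : ∀ k, r (σ k) = (finSigmaFinEquiv.symm k).1 := fun k =>
    (e (finSigmaFinEquiv.symm k)).2.2
  have key := (hf.contDiffAt (n := ⊤)).iteratedFDeriv_comp_perm
    (fun k => Pi.single (r k) (1 : ℂ)) σ
  rw [← key]
  simp only [Function.comp_def, hσ]
  simpa [taylorCoeff, Nat.factorial_ne_zero, Finset.prod_eq_zero_iff] using h

/-- An analytic function vanishes near `0` at the points where all the terms of its Taylor series
vanish. -/
theorem AnalyticAt.eventually_eq_zero_of_iteratedFDeriv {E F : Type*} [NormedAddCommGroup E]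
    [NormedSpace ℂ E] [NormedAddCommGroup F] [NormedSpace ℂ F] [CompleteSpace F] {f : E → F}
    (hf : AnalyticAt ℂ f 0) :
    ∀ᶠ z in 𝓝 (0 : E), (∀ m, iteratedFDeriv ℂ m f 0 (fun _ => z) = 0) → f z = 0 := by
  obtain ⟨p, r, hp⟩ := hf
  filter_upwards [Metric.eball_mem_nhds (0 : E) hp.r_pos] with z hz h
  have := hp.hasSum_iteratedFDeriv hz
  simp only [h, smul_zero, zero_add] at this
  exact this.unique hasSum_zero

/-- A holomorphic function of two variables has no isolated zero. -/
theorem AnalyticAt.frequently_eq_zero_prod {h : ℂ × ℂ → ℂ} (hh : AnalyticAt ℂ h 0)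
    (h0 : h 0 = 0) : ∃ᶠ p in 𝓝[≠] (0 : ℂ × ℂ), h p = 0 := by
  intro hne
  have hne' := eventually_nhdsWithin_iff.1 hne
  obtain ⟨ε, hε, hball⟩ := Metric.eventually_nhds_iff.1 (hne'.and hh.eventually_analyticAt)
  set r := ε / 2 with hr
  have hr0 : 0 < r := by positivity
  have hmem : ∀ x y : ℂ, ‖x‖ ≤ r → ‖y‖ ≤ r → dist (x, y) (0 : ℂ × ℂ) < ε := by
    intro x y hx hy
    rw [dist_zero_right, Prod.norm_def]
    exact (max_le hx hy).trans_lt (by linarith)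
  have hK : IsCompact (Metric.sphere (0 : ℂ) r ×ˢ Metric.closedBall (0 : ℂ) r) :=
    (isCompact_sphere _ _).prod (isCompact_closedBall _ _)
  have hKne : (Metric.sphere (0 : ℂ) r ×ˢ Metric.closedBall (0 : ℂ) r).Nonempty :=
    ⟨((r : ℂ), 0), by simp [abs_of_pos hr0], by simp [hr0.le]⟩
  have hcont : ContinuousOn (fun p => ‖h p‖)
      (Metric.sphere (0 : ℂ) r ×ˢ Metric.closedBall (0 : ℂ) r) := by
    rintro ⟨x, y⟩ ⟨hx, hy⟩
    simp only [mem_sphere_zero_iff_norm, mem_closedBall_zero_iff] at hx hy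
    exact (hball (hmem x y hx.le hy)).2.continuousAt.norm.continuousWithinAt
  obtain ⟨⟨a, b⟩, ⟨ha, hb⟩, hmin⟩ := hK.exists_isMinOn hKne hcont
  simp only [mem_sphere_zero_iff_norm, mem_closedBall_zero_iff] at ha hb
  set δ := ‖h (a, b)‖ with hδ
  have hδ0 : 0 < δ := by
    refine norm_pos_iff.2 ((hball (hmem a b ha.le hb)).1 ?_)
    intro hab
    have : a = 0 := congrArg Prod.fst hab
    rw [this, norm_zero] at ha
    exact hr0.ne ha
  -- For fixed y ≠ 0 the reciprocal of h is holomorphic on the whole disc in x, so the maximum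
  -- principle carries the bound from |x| = r to x = 0. Letting y tend to 0 then contradicts h(0) =
  -- 0.
  have hlow : ∀ y : ℂ, y ≠ 0 → ‖y‖ ≤ r → δ ≤ ‖h (0, y)‖ := by
    intro y hy0 hy
    have hnz : ∀ x : ℂ, ‖x‖ ≤ r → h (x, y) ≠ 0 := fun x hx =>
      (hball (hmem x y hx hy)).1 (by simp [hy0])
    have hd : DifferentiableOn ℂ (fun x => (h (x, y))⁻¹) (Metric.closedBall 0 r) := by
      intro x hx
      rw [mem_closedBall_zero_iff] at hx
      have h1 : DifferentiableAt ℂ h (x, y) := (hball (hmem x y hx hy)).2.differentiableAt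
      have h2 : DifferentiableAt ℂ (fun x => h (x, y)) x :=
        h1.comp x (differentiableAt_id.prodMk (differentiableAt_const y))
      exact (h2.inv (hnz x hx)).differentiableWithinAt
    have hdc : DiffContOnCl ℂ (fun x => (h (x, y))⁻¹) (Metric.ball 0 r) :=
      hd.diffContOnCl_ball subset_rfl
    have := Complex.norm_le_of_forall_mem_frontier_norm_le (C := δ⁻¹) Metric.isBounded_ball hdc
      (fun x hx => by
        rw [frontier_ball _ hr0.ne'] at hx
        rw [norm_inv]
        exact inv_anti₀ hδ0 (hmin (a := (x, y)) ⟨hx, by simpa using hy⟩))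
      (subset_closure (Metric.mem_ball_self hr0))
    rw [norm_inv] at this
    exact (inv_le_inv₀ (norm_pos_iff.2 (hnz 0 (by simpa using hr0.le))) hδ0).1 this
  have hlim : Tendsto (fun y : ℂ => ‖h (0, y)‖) (𝓝[≠] 0) (𝓝 0) := by
    have h1 : ContinuousAt (fun y : ℂ => ‖h (0, y)‖) 0 := by
      refine ContinuousAt.norm ?_
      exact ContinuousAt.comp (f := fun y : ℂ => ((0 : ℂ), y)) (x := 0) (g := h)
        hh.continuousAt (by fun_prop)
    have h2 := h1.tendsto
    have h3 : h ((0 : ℂ), (0 : ℂ)) = 0 := h0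
    simp only [h3, norm_zero] at h2
    exact h2.mono_left nhdsWithin_le_nhds
  have : δ ≤ 0 := by
    refine ge_of_tendsto hlim ?_
    have h1 : ∀ᶠ y in 𝓝[≠] (0 : ℂ), y ≠ 0 := eventually_mem_nhdsWithin
    have h2 : ∀ᶠ y in 𝓝[≠] (0 : ℂ), ‖y‖ ≤ r :=
      nhdsWithin_le_nhds (by
        filter_upwards [Metric.closedBall_mem_nhds (0 : ℂ) hr0] with y hy
        simpa using hy)
    filter_upwards [h1, h2] with y h1 h2 using hlow y h1 h2
  exact absurd this (not_le.2 hδ0)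

/-! ### The Taylor support of an isolated singularity. -/

/-- A singularity has no terms of order `0` or `1`. -/
theorem IsSingularity.two_le_sum {n : ℕ} {f : (Fin n → ℂ) → ℂ} (hf : IsSingularity f)
    {ν : Fin n → ℕ} (hν : taylorCoeff f ν ≠ 0) : 2 ≤ ∑ i, ν i := by
  by_contra hlt
  refine hν ?_
  have low : ∀ N < 2, ∀ w : Fin N → Fin n,
      iteratedFDeriv ℂ N f 0 (fun j => Pi.single (w j) (1 : ℂ)) = 0 := by
    intro N hN w
    interval_cases N
    · rw [iteratedFDeriv_zero_apply, hf.map_zero]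
    · rw [iteratedFDeriv_one_apply]
      exact congrFun hf.gradient_zero (w 0)
  rw [taylorCoeff, low _ (by omega), zero_div]

/-- The support of an isolated singularity contains, for each `i`, a monomial `z_i ^ a * z_j`. -/
theorem IsIsolatedSingularity.exists_nsmul_single_add_single {n : ℕ} {f : (Fin n → ℂ) → ℂ}
    (hf : IsIsolatedSingularity f) (i : Fin n) :
    ∃ (a : ℕ) (j : Fin n), taylorCoeff f (Pi.single i a + Pi.single j 1) ≠ 0 := by
  by_contra! hno
  have hgrad : ∀ᶠ z in 𝓝 (0 : Fin n → ℂ), (∀ m, iteratedFDeriv ℂ m (fderiv ℂ f) 0 (fun _ => z) = 0)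
      → fderiv ℂ f z = 0 := hf.holomorphic.fderiv.eventually_eq_zero_of_iteratedFDeriv
  have hcurve : Tendsto (fun t : ℂ => (Pi.single i t : Fin n → ℂ)) (𝓝[≠] 0) (𝓝[≠] 0) := by
    refine tendsto_nhdsWithin_iff.2 ⟨?_, ?_⟩
    · have : Continuous (fun t : ℂ => (Pi.single i t : Fin n → ℂ)) :=
        (ContinuousLinearMap.single ℂ (fun _ : Fin n => ℂ) i).continuous
      have h := this.tendsto 0
      rw [Pi.single_zero] at h
      exact h.mono_left nhdsWithin_le_nhds
    · filter_upwards [self_mem_nhdsWithin] with t ht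
      simpa using ht
  have h1 := hcurve.eventually (hgrad.filter_mono nhdsWithin_le_nhds)
  have h2 := hcurve.eventually hf.isolated
  obtain ⟨t, h1, h2⟩ := (h1.and h2).exists
  refine h2 ?_
  have hz : fderiv ℂ f (Pi.single i t) = 0 := by
    refine h1 fun m => ?_
    have hsm : (Pi.single i t : Fin n → ℂ) = t • Pi.single i (1 : ℂ) := by
      rw [← Pi.single_smul, smul_eq_mul, mul_one]
    rw [hsm, ContinuousMultilinearMap.map_smul_univ (iteratedFDeriv ℂ m (fderiv ℂ f) 0)
      (fun _ => t) (fun _ => Pi.single i (1 : ℂ))]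
    convert smul_zero _
    refine ContinuousLinearMap.coe_injective (LinearMap.pi_ext' fun j => LinearMap.ext_ring ?_)
    -- Differentiating ∂_j f m times along e_i gives, up to a factorial factor, the coefficient of
    -- z_i^m z_j in f.
    have h3 := iteratedFDeriv_succ_apply_right (𝕜 := ℂ) (f := f) (x := 0) (n := m)
      (Fin.snoc (fun _ => Pi.single i (1 : ℂ)) (Pi.single j (1 : ℂ)))
    simp only [Fin.init_snoc, Fin.snoc_last] at h3
    simp only [LinearMap.coe_comp, Function.comp_apply, LinearMap.coe_single,
      ContinuousLinearMap.coe_coe, zero_apply]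
    rw [← h3]
    have h4 : (Fin.snoc (fun _ => Pi.single i (1 : ℂ)) (Pi.single j (1 : ℂ)) :
        Fin (m + 1) → Fin n → ℂ) = fun k => Pi.single ((Fin.snoc (fun _ => i) j :
          Fin (m + 1) → Fin n) k) (1 : ℂ) := by
      funext k
      refine Fin.lastCases ?_ (fun k => ?_) k <;> simp
    rw [h4]
    refine iteratedFDeriv_single_eq_zero hf.holomorphic _ _ (fun l => ?_) (hno m j)
    rw [Fintype.card_subtype, Finset.card_filter, Fin.sum_univ_castSucc]
    simp [Pi.single_apply, eq_comm]
  funext j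
  simp [complexGradient, hz]

/-- The support of an isolated singularity in at least three variables meets every coordinate
hyperplane. -/
theorem IsIsolatedSingularity.exists_taylorCoeff_ne_zero_apply_eq_zero {n : ℕ}
    {f : (Fin n → ℂ) → ℂ} (hf : IsIsolatedSingularity f) {i j k : Fin n} (hij : i ≠ j)
    (hik : i ≠ k) (hjk : j ≠ k) : ∃ ν : Fin n → ℕ, taylorCoeff f ν ≠ 0 ∧ ν i = 0 := by
  by_contra! hno
  have hplane : ∀ᶠ z in 𝓝 (0 : Fin n → ℂ), z i = 0 → f z = 0 := by
    filter_upwards [hf.holomorphic.eventually_eq_zero_of_iteratedFDeriv] with z hz hzi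
    refine hz fun m => ?_
    have hsum : z = ∑ l, z l • (Pi.single l (1 : ℂ) : Fin n → ℂ) := pi_eq_sum_univ' z
    rw [hsum, ContinuousMultilinearMap.map_sum (iteratedFDeriv ℂ m f 0)
      (fun _ l => z l • (Pi.single l (1 : ℂ) : Fin n → ℂ))]
    refine Finset.sum_eq_zero fun r _ => ?_
    rw [ContinuousMultilinearMap.map_smul_univ (iteratedFDeriv ℂ m f 0)
      (fun k => z (r k)) (fun k => Pi.single (r k) (1 : ℂ))]
    -- A term using direction `i` carries the factor z_i = 0; any other belongs to an exponent with
    -- ν_i = 0, excluded by `hno`.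
    by_cases hr : ∃ k, r k = i
    · obtain ⟨k, hk⟩ := hr
      rw [Finset.prod_eq_zero (Finset.mem_univ k) (by rw [hk, hzi]), zero_smul]
    · rw [iteratedFDeriv_single_eq_zero hf.holomorphic r (fun i => Fintype.card {k // r k = i})
        (fun _ => rfl), smul_zero]
      by_contra hne
      refine hno _ hne ?_
      push Not at hr
      rw [Fintype.card_eq_zero_iff]
      exact ⟨fun x => hr x.1 x.2⟩
  have hgrad : ∀ᶠ z in 𝓝 (0 : Fin n → ℂ), z i = 0 → ∀ l, l ≠ i → complexGradient f z l = 0 := by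
    filter_upwards [hplane.eventually_nhds, hf.holomorphic.eventually_analyticAt] with z hz ha hzi l hl
    have hline : HasDerivAt (fun t : ℂ => z + t • (Pi.single l (1 : ℂ) : Fin n → ℂ))
        (Pi.single l (1 : ℂ)) 0 := by
      simpa using ((hasDerivAt_id (0 : ℂ)).smul_const (Pi.single l (1 : ℂ) : Fin n → ℂ)).const_add z
    have hfd : HasFDerivAt f (fderiv ℂ f z) (z + (0 : ℂ) • (Pi.single l (1 : ℂ) : Fin n → ℂ)) := by
      simpa using ha.differentiableAt.hasFDerivAt
    have hd := hfd.comp_hasDerivAt (0 : ℂ) hline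
    have hc : Tendsto (fun t : ℂ => z + t • (Pi.single l (1 : ℂ) : Fin n → ℂ)) (𝓝 0) (𝓝 z) := by
      simpa using hline.continuousAt.tendsto
    have hzero : f ∘ (fun t : ℂ => z + t • (Pi.single l (1 : ℂ) : Fin n → ℂ)) =ᶠ[𝓝 0]
        fun _ => 0 := by
      filter_upwards [hc.eventually hz] with t ht
      exact ht (by simp [hzi, hl.symm])
    exact (hd.congr_of_eventuallyEq hzero.symm).unique (hasDerivAt_const _ _)
  -- On z_i = 0 only ∂_i f can be nonzero; restricted to the span of e_j and e_k it is a function of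
  -- two variables vanishing at 0.
  let L : ℂ × ℂ →L[ℂ] (Fin n → ℂ) :=
    (ContinuousLinearMap.fst ℂ ℂ ℂ).smulRight (Pi.single j (1 : ℂ)) +
      (ContinuousLinearMap.snd ℂ ℂ ℂ).smulRight (Pi.single k (1 : ℂ))
  have hLj : ∀ p, L p j = p.1 := fun p => by simp [L, hjk]
  have hLk : ∀ p, L p k = p.2 := fun p => by simp [L, hjk.symm]
  have hLi : ∀ p, L p i = 0 := fun p => by simp [L, hij, hik]
  have hLt : Tendsto L (𝓝[≠] 0) (𝓝[≠] 0) := by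
    refine tendsto_nhdsWithin_iff.2 ⟨?_, ?_⟩
    · have h := L.continuous.tendsto 0
      rw [map_zero] at h
      exact h.mono_left nhdsWithin_le_nhds
    · filter_upwards [self_mem_nhdsWithin] with p hp h0
      refine hp (Prod.ext ?_ ?_)
      · rw [← hLj p, h0]; rfl
      · rw [← hLk p, h0]; rfl
  have hh : AnalyticAt ℂ (fun p => complexGradient f (L p) i) 0 := by
    have h1 : AnalyticAt ℂ (fun p => fderiv ℂ f (L p)) 0 :=
      AnalyticAt.fun_comp (by simpa using hf.holomorphic.fderiv) (L.analyticAt 0)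
    exact ((ContinuousLinearMap.apply ℂ ℂ (Pi.single i (1 : ℂ))).analyticAt _).comp h1
  have hfreq := hh.frequently_eq_zero_prod (by simp [hf.gradient_zero])
  obtain ⟨p, hp, hp1, hp2⟩ := (hfreq.and_eventually ((hLt.eventually hf.isolated).and
    (hLt.eventually (hgrad.filter_mono nhdsWithin_le_nhds)))).exists
  refine hp1 (funext fun l => ?_)
  by_cases hl : l = i
  · rw [hl]; exact hp
  · exact hp2 (hLi p) l hl

/-! ### Weights and minimal exponents. -/

/-- The weight `⟨u, ν⟩` of an exponent `ν`. -/
def exponentWeight {n : ℕ} (u : Fin n → ℝ) (ν : Fin n → ℕ) : ℝ := ∑ i, u i * ν i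

/-- The elements of `S` of smallest weight with respect to `u`. -/
def minimalExponents {n : ℕ} (S : Set (Fin n → ℕ)) (u : Fin n → ℝ) : Set (Fin n → ℕ) :=
  {ν | ν ∈ S ∧ ∀ ξ ∈ S, exponentWeight u ν ≤ exponentWeight u ξ}

section Weight

variable {n : ℕ} {S : Set (Fin n → ℕ)} {u v : Fin n → ℝ} {μ ν ξ : Fin n → ℕ}

theorem exponentWeight_add (u v : Fin n → ℝ) (ν : Fin n → ℕ) :
    exponentWeight (u + v) ν = exponentWeight u ν + exponentWeight v ν := by
  simp [exponentWeight, add_mul, Finset.sum_add_distrib]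

theorem exponentWeight_smul (s : ℝ) (u : Fin n → ℝ) (ν : Fin n → ℕ) :
    exponentWeight (s • u) ν = s * exponentWeight u ν := by
  simp [exponentWeight, mul_assoc, Finset.mul_sum]

theorem exponentWeight_single (i : Fin n) (s : ℝ) (ν : Fin n → ℕ) :
    exponentWeight (Pi.single i s) ν = s * ν i := by
  simp [exponentWeight, Pi.single_apply]

theorem single_apply_nonneg (i : Fin n) {s : ℝ} (hs : 0 ≤ s) (l : Fin n) :
    0 ≤ (Pi.single i s : Fin n → ℝ) l := by
  rw [Pi.single_apply]
  split_ifs <;> simp [hs]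

theorem exponentWeight_nonneg (hu : ∀ i, 0 ≤ u i) (ν : Fin n → ℕ) : 0 ≤ exponentWeight u ν :=
  Finset.sum_nonneg fun i _ => mul_nonneg (hu i) (Nat.cast_nonneg _)

theorem mul_apply_le_exponentWeight (hu : ∀ i, 0 ≤ u i) (ν : Fin n → ℕ) (i : Fin n) :
    u i * ν i ≤ exponentWeight u ν :=
  Finset.single_le_sum (f := fun i => u i * ν i)
    (fun i _ => mul_nonneg (hu i) (Nat.cast_nonneg _)) (Finset.mem_univ i)

theorem finite_setOf_exponentWeight_le (hu : ∀ i, 0 < u i) (C : ℝ) :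
    {ν : Fin n → ℕ | exponentWeight u ν ≤ C}.Finite := by
  refine (Set.finite_Iic (fun i => ⌊C / u i⌋₊)).subset fun ν hν i => ?_
  refine Nat.le_floor ((le_div_iff₀' (hu i)).2 ?_)
  exact (mul_apply_le_exponentWeight (fun i => (hu i).le) ν i).trans hν

theorem minimalExponents_nonempty (hu : ∀ i, 0 < u i) (hS : S.Nonempty) :
    (minimalExponents S u).Nonempty := by
  obtain ⟨ξ, hξ⟩ := hS
  obtain ⟨μ, ⟨hμ, hμξ⟩, hmin⟩ := Set.exists_min_image
    {ν | ν ∈ S ∧ exponentWeight u ν ≤ exponentWeight u ξ} (exponentWeight u)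
    ((finite_setOf_exponentWeight_le hu _).subset fun ν hν => hν.2) ⟨ξ, hξ, le_rfl⟩
  refine ⟨μ, hμ, fun ν hν => ?_⟩
  rcases le_total (exponentWeight u ν) (exponentWeight u ξ) with h | h
  · exact hmin ν ⟨hν, h⟩
  · exact hμξ.trans h

theorem minimalExponents_finite (hu : ∀ i, 0 < u i) (S : Set (Fin n → ℕ)) :
    (minimalExponents S u).Finite := by
  rcases (minimalExponents S u).eq_empty_or_nonempty with h | ⟨μ, hμ⟩
  · simp [h]
  · exact (finite_setOf_exponentWeight_le hu (exponentWeight u μ)).subset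
      fun ν hν => hν.2 μ hμ.1

theorem exponentWeight_eq_of_mem_minimalExponents (hμ : μ ∈ minimalExponents S u)
    (hν : ν ∈ minimalExponents S u) : exponentWeight u μ = exponentWeight u ν :=
  le_antisymm (hμ.2 ν hν.1) (hν.2 μ hμ.1)

/-- Moving `u` in the direction `v`, a minimal exponent `μ` that is not minimal for `v` stays
minimal until it is joined by an exponent of smaller `v`-weight. -/
theorem exists_mem_minimalExponents_add_smul (hu : ∀ i, 0 < u i) (hv : ∀ i, 0 ≤ v i)
    (hμ : μ ∈ minimalExponents S u) (hξ : ξ ∈ S)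
    (hlt : exponentWeight v ξ < exponentWeight v μ) :
    ∃ s : ℝ, 0 ≤ s ∧ μ ∈ minimalExponents S (u + s • v) ∧
      ∃ ξ' ∈ minimalExponents S (u + s • v), exponentWeight v ξ' < exponentWeight v μ := by
  -- `ρ ν` is the parameter s at which ν and μ have equal weight for u + s v. The least such value
  -- exists because `ρ ν ≤ ρ ξ` bounds the u-weight of ν.
  set ρ : (Fin n → ℕ) → ℝ := fun ν =>
    (exponentWeight u ν - exponentWeight u μ) / (exponentWeight v μ - exponentWeight v ν) with hρ
  have hρ_mul : ∀ ν, exponentWeight v ν < exponentWeight v μ →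
      ρ ν * (exponentWeight v μ - exponentWeight v ν) =
        exponentWeight u ν - exponentWeight u μ := fun ν hν =>
    div_mul_cancel₀ _ (sub_pos.2 hν).ne'
  have hρ_nonneg : ∀ ν ∈ S, exponentWeight v ν < exponentWeight v μ → 0 ≤ ρ ν := fun ν hν h =>
    div_nonneg (sub_nonneg.2 (hμ.2 ν hν)) (sub_pos.2 h).le
  obtain ⟨ζ, ⟨hζ, hζlt, hζρ⟩, hmin⟩ := Set.exists_min_image
    {ν | ν ∈ S ∧ exponentWeight v ν < exponentWeight v μ ∧ ρ ν ≤ ρ ξ} ρ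
    ((finite_setOf_exponentWeight_le hu
      (exponentWeight u μ + ρ ξ * exponentWeight v μ)).subset (by
        rintro ν ⟨hν, hlt', hle⟩
        have h1 := hρ_mul ν hlt'
        have h2 := mul_le_mul_of_nonneg_right hle (sub_pos.2 hlt').le
        have h3 := mul_nonneg (hρ_nonneg ξ hξ hlt) (exponentWeight_nonneg hv ν)
        simp only [Set.mem_ofPred_eq]
        linarith)) ⟨ξ, hξ, hlt, le_rfl⟩
  have hw : ∀ ν, exponentWeight (u + ρ ζ • v) ν =
      exponentWeight u ν + ρ ζ * exponentWeight v ν := fun ν => by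
    rw [exponentWeight_add, exponentWeight_smul]
  have hμ' : ∀ ν ∈ S, exponentWeight (u + ρ ζ • v) μ ≤ exponentWeight (u + ρ ζ • v) ν := by
    intro ν hν
    rw [hw, hw]
    rcases lt_or_ge (exponentWeight v ν) (exponentWeight v μ) with h | h
    · have hle : ρ ζ ≤ ρ ν := by
        rcases le_total (ρ ν) (ρ ξ) with h' | h'
        · exact hmin ν ⟨hν, h, h'⟩
        · exact hζρ.trans h'
      have h1 := hρ_mul ν h
      have h2 := mul_le_mul_of_nonneg_right hle (sub_pos.2 h).le
      linarith
    · have h1 := mul_le_mul_of_nonneg_left h (hρ_nonneg ζ hζ hζlt)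
      have h2 := hμ.2 ν hν
      linarith
  refine ⟨ρ ζ, hρ_nonneg ζ hζ hζlt, ⟨hμ.1, hμ'⟩, ζ, ⟨hζ, fun ν hν => ?_⟩, hζlt⟩
  have h1 := hρ_mul ζ hζlt
  have h2 := hμ' ν hν
  rw [hw μ] at h2
  rw [hw ζ]
  linarith

end Weight

/-! ### Edges of a support without compact 2-faces. -/

/-- The minimal exponents for each positive weight lie on a line. -/
def HasCollinearMinimalExponents {n : ℕ} (S : Set (Fin n → ℕ)) : Prop :=
  ∀ u : Fin n → ℝ, (∀ i, 0 < u i) → ∀ μ ∈ minimalExponents S u, ∀ ν ∈ minimalExponents S u,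
    μ ≠ ν → ∀ ξ ∈ minimalExponents S u, ∀ v : Fin n → ℝ,
      exponentWeight v μ = exponentWeight v ν → exponentWeight v ξ = exponentWeight v μ

/-- If some exponent had smaller v-weight, tilting u towards v would keep μ and ν minimal together
until an exponent of smaller v-weight joined them, off their line. -/
theorem HasCollinearMinimalExponents.le_of_exponentWeight_eq {n : ℕ} {S : Set (Fin n → ℕ)}
    (hS : HasCollinearMinimalExponents S) {u v : Fin n → ℝ} {μ ν : Fin n → ℕ}
    (hu : ∀ i, 0 < u i) (hμ : μ ∈ minimalExponents S u) (hν : ν ∈ minimalExponents S u)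
    (hne : μ ≠ ν) (hv : ∀ i, 0 ≤ v i) (heq : exponentWeight v μ = exponentWeight v ν)
    {ξ : Fin n → ℕ} (hξ : ξ ∈ S) : exponentWeight v μ ≤ exponentWeight v ξ := by
  by_contra! hlt
  obtain ⟨s, hs, hμ', ζ, hζ, hζlt⟩ := exists_mem_minimalExponents_add_smul hu hv hμ hξ hlt
  have hν' : ν ∈ minimalExponents S (u + s • v) := by
    refine ⟨hν.1, fun χ hχ => ?_⟩
    have := hμ'.2 χ hχ
    rw [exponentWeight_add u (s • v) μ, exponentWeight_smul, heq,
      exponentWeight_eq_of_mem_minimalExponents hμ hν, ← exponentWeight_smul,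
      ← exponentWeight_add] at this
    exact this
  refine hζlt.ne (hS _ (fun i => ?_) μ hμ' ν hν' hne ζ hζ v heq)
  simpa using add_pos_of_pos_of_nonneg (hu i) (mul_nonneg hs (hv i))

/-- The conditions that the support of an isolated singularity satisfies. -/
structure IsIsolatedSupport {n : ℕ} (S : Set (Fin n → ℕ)) : Prop where
  two_le_sum : ∀ ν ∈ S, 2 ≤ ∑ i, ν i
  exists_axis : ∀ i, ∃ (a : ℕ) (j : Fin n), Pi.single i a + Pi.single j 1 ∈ S
  exists_plane : ∀ i, ∃ ν ∈ S, ν i = 0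

namespace IsIsolatedSupport

theorem _root_.Fin.sum_eq_of_ne {M : Type*} [AddCommMonoid M] {i j k : Fin 3} (hij : i ≠ j)
    (hik : i ≠ k) (hjk : j ≠ k) (g : Fin 3 → M) : ∑ l, g l = g i + g j + g k := by
  have h : (Finset.univ : Finset (Fin 3)) = {i, j, k} := by
    revert i j k; decide
  rw [h, Finset.sum_insert (by simp [hij, hik]), Finset.sum_insert (by simp [hjk]),
    Finset.sum_singleton, add_assoc]

theorem _root_.Fin.eq_or_eq_or_eq_of_ne {i j k : Fin 3} (hij : i ≠ j)
    (hik : i ≠ k) (hjk : j ≠ k) (l : Fin 3) : l = i ∨ l = j ∨ l = k := by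
  revert i j k l; decide

variable {S : Set (Fin 3 → ℕ)} {u : Fin 3 → ℝ} {μ ν : Fin 3 → ℕ} {i j k : Fin 3}

/-- The functional in coordinates i and j that is constant on the edge has positive coefficients
there and ignores coordinate k. On the monomial `z_k ^ a * z_l` its value is at most one of these
coefficients, so its value on the edge is just as small. -/
theorem apply_eq_zero_of_lt_of_lt (hS : IsIsolatedSupport S) (hc : HasCollinearMinimalExponents S)
    (hu : ∀ i, 0 < u i) (hμ : μ ∈ minimalExponents S u) (hν : ν ∈ minimalExponents S u)
    (hij : i ≠ j) (hik : i ≠ k) (hjk : j ≠ k) (hi : ν i < μ i) (hj : μ j < ν j) :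
    ν i = 0 ∧ μ j = 0 ∧ (μ i = 1 ∨ ν j = 1) := by
  obtain ⟨α, hα⟩ := Nat.exists_eq_add_of_lt hi
  obtain ⟨β, hβ⟩ := Nat.exists_eq_add_of_lt hj
  obtain ⟨a, l, hal⟩ := hS.exists_axis k
  have hne : μ ≠ ν := fun h => hi.ne (by rw [h])
  -- The coefficients are the differences ν_j - μ_j = β + 1 and μ_i - ν_i = α + 1, which make the
  -- weights of μ and ν agree.
  have key := hc.le_of_exponentWeight_eq (v := Pi.single i ((β + 1 : ℕ) : ℝ) +
    Pi.single j ((α + 1 : ℕ) : ℝ)) hu hμ hν hne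
    (fun l => add_nonneg (single_apply_nonneg i (Nat.cast_nonneg _) l)
      (single_apply_nonneg j (Nat.cast_nonneg _) l))
    (by
      simp only [exponentWeight_add, exponentWeight_single, hα, hβ]
      push_cast
      ring) hal
  simp only [exponentWeight_add, exponentWeight_single, Pi.add_apply] at key
  rw [Pi.single_eq_of_ne hik, Pi.single_eq_of_ne hjk] at key
  norm_cast at key
  rw [hα] at key
  have h1 : 0 ≤ (β + 1) * ν i := Nat.zero_le _
  rcases Fin.eq_or_eq_or_eq_of_ne hij hik hjk l with rfl | rfl | rfl
  · rw [Pi.single_eq_same, Pi.single_eq_of_ne hij.symm] at key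
    have h2 : ν l = 0 ∧ α = 0 := by
      by_contra h
      have : 2 ≤ ν l + α + 1 := by omega
      nlinarith
    obtain ⟨h2, rfl⟩ := h2
    rw [h2] at key
    exact ⟨h2, by omega, Or.inl (by omega)⟩
  · rw [Pi.single_eq_same, Pi.single_eq_of_ne hij] at key
    have h2 : μ l = 0 := by
      by_contra h
      have : 1 ≤ μ l := by omega
      nlinarith
    have h3 : ν i = 0 := by
      by_contra h
      have : 1 ≤ ν i := by omega
      nlinarith
    have h4 : β = 0 := by
      by_contra h
      have : 1 ≤ β := by omega
      nlinarith
    exact ⟨h3, h2, Or.inr (by omega)⟩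
  · rw [Pi.single_eq_of_ne hik, Pi.single_eq_of_ne hjk] at key
    nlinarith

/-- The k-th coordinate is constant on the edge, hence 0 there because the support meets that plane.
Both ends then lie on axes and one of them has degree 1. -/
theorem false_of_lt_of_lt_of_eq (hS : IsIsolatedSupport S) (hc : HasCollinearMinimalExponents S)
    (hu : ∀ i, 0 < u i) (hμ : μ ∈ minimalExponents S u) (hν : ν ∈ minimalExponents S u)
    (hij : i ≠ j) (hik : i ≠ k) (hjk : j ≠ k) (hi : ν i < μ i) (hj : μ j < ν j)
    (hk : μ k = ν k) : False := by
  obtain ⟨h1, h2, h3⟩ := hS.apply_eq_zero_of_lt_of_lt hc hu hμ hν hij hik hjk hi hj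
  obtain ⟨ξ, hξ, hξk⟩ := hS.exists_plane k
  have hne : μ ≠ ν := fun h => hi.ne (by rw [h])
  have key := hc.le_of_exponentWeight_eq (v := Pi.single k 1) hu hμ hν hne
    (single_apply_nonneg k zero_le_one) (by simp [exponentWeight_single, hk]) hξ
  simp only [exponentWeight_single, hξk, one_mul] at key
  norm_cast at key
  have hsμ := hS.two_le_sum μ hμ.1
  have hsν := hS.two_le_sum ν hν.1
  rw [Fin.sum_eq_of_ne hij hik hjk] at hsμ hsν
  omega

/-- The preceding bounds for (i, j) and (i, k) put μ on the i-th axis; its degree rules out μ_i = 1,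
which leaves ν_j = ν_k = 1. -/
theorem eq_single_of_lt_of_lt_of_lt (hS : IsIsolatedSupport S)
    (hc : HasCollinearMinimalExponents S)
    (hu : ∀ i, 0 < u i) (hμ : μ ∈ minimalExponents S u) (hν : ν ∈ minimalExponents S u)
    (hij : i ≠ j) (hik : i ≠ k) (hjk : j ≠ k) (hi : ν i < μ i) (hj : μ j < ν j)
    (hk : μ k < ν k) :
    ∃ m, 2 ≤ m ∧ μ = Pi.single i m ∧ ν = fun l => if l = i then 0 else 1 := by
  obtain ⟨h1, h2, h3⟩ := hS.apply_eq_zero_of_lt_of_lt hc hu hμ hν hij hik hjk hi hj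
  obtain ⟨-, h4, h5⟩ := hS.apply_eq_zero_of_lt_of_lt hc hu hμ hν hik hij hjk.symm hi hk
  have hsμ := hS.two_le_sum μ hμ.1
  rw [Fin.sum_eq_of_ne hij hik hjk] at hsμ
  refine ⟨μ i, by omega, funext fun l => ?_, funext fun l => ?_⟩
  · rcases Fin.eq_or_eq_or_eq_of_ne hij hik hjk l with rfl | rfl | rfl
    · rw [Pi.single_eq_same]
    · rw [Pi.single_eq_of_ne hij.symm, h2]
    · rw [Pi.single_eq_of_ne hik.symm, h4]
  · rcases Fin.eq_or_eq_or_eq_of_ne hij hik hjk l with rfl | rfl | rfl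
    · rw [if_pos rfl, h1]
    · rw [if_neg hij.symm]; omega
    · rw [if_neg hik.symm]; omega

/-- The ends of an edge are the end points of a member of `segmentFamilyJ`. -/
theorem exists_eq_single (hS : IsIsolatedSupport S)
    (hc : HasCollinearMinimalExponents S)
    (hu : ∀ i, 0 < u i) (hμ : μ ∈ minimalExponents S u) (hν : ν ∈ minimalExponents S u)
    (hne : μ ≠ ν) : ∃ (i : Fin 3) (m : ℕ), 2 ≤ m ∧
      ((μ = Pi.single i m ∧ ν = fun l => if l = i then 0 else 1) ∨
        (ν = Pi.single i m ∧ μ = fun l => if l = i then 0 else 1)) := by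
  have aux : ∀ {μ ν : Fin 3 → ℕ}, μ ∈ minimalExponents S u → ν ∈ minimalExponents S u →
      μ ≠ ν → ∃ i, ν i < μ i := by
    intro μ ν hμ hν hne
    -- Comparable exponents of equal positive weight coincide.
    by_contra! hle
    refine hne (funext fun i => (hle i).antisymm ?_)
    have heq := exponentWeight_eq_of_mem_minimalExponents hμ hν
    have := (Finset.sum_eq_sum_iff_of_le (fun l _ =>
      mul_le_mul_of_nonneg_left (Nat.cast_le.2 (hle l)) (hu l).le)).1 heq i (Finset.mem_univ i)
    exact (Nat.cast_injective (mul_left_cancel₀ (hu i).ne' this)).ge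
  obtain ⟨i, hi⟩ := aux hμ hν hne
  obtain ⟨j, hj⟩ := aux hν hμ hne.symm
  have hij : i ≠ j := by
    rintro rfl
    omega
  obtain ⟨k, hik, hjk⟩ : ∃ k, i ≠ k ∧ j ≠ k := by
    clear hi hj
    revert i j; decide
  rcases lt_trichotomy (μ k) (ν k) with h | h | h
  · obtain ⟨m, hm, h⟩ := hS.eq_single_of_lt_of_lt_of_lt hc hu hμ hν hij hik hjk hi hj h
    exact ⟨i, m, hm, Or.inl h⟩
  · exact (hS.false_of_lt_of_lt_of_eq hc hu hμ hν hij hik hjk hi hj h).elim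
  · obtain ⟨m, hm, h⟩ := hS.eq_single_of_lt_of_lt_of_lt hc hu hν hμ hij.symm hjk hik hj hi h
    exact ⟨j, m, hm, Or.inr h⟩

/-- There is only one edge. -/
theorem index_eq_and_eq (hc : HasCollinearMinimalExponents S) {v : Fin 3 → ℝ}
    (hu : ∀ i, 0 < u i) (hv : ∀ i, 0 < v i) {m m' : ℕ} (hm : 2 ≤ m)
    (hμ : Pi.single i m ∈ minimalExponents S u)
    (hν : (fun l => if l = i then 0 else 1) ∈ minimalExponents S u)
    (hμ' : Pi.single j m' ∈ minimalExponents S v)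
    (hν' : (fun l => if l = j then 0 else 1) ∈ minimalExponents S v) : i = j ∧ m = m' := by
  by_cases hij : i = j
  · subst hij
    have h1 := hμ.2 _ hμ'.1
    have h2 := hμ'.2 _ hμ.1
    simp only [exponentWeight, Pi.single_apply, Nat.cast_ite, Nat.cast_zero, mul_ite, mul_zero,
      Finset.sum_ite_eq', Finset.mem_univ, if_true] at h1 h2
    have h1 := le_of_mul_le_mul_left h1 (hu i)
    have h2 := le_of_mul_le_mul_left h2 (hv i)
    norm_cast at h1 h2
    exact ⟨rfl, h1.antisymm h2⟩
  · exfalso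
    have hne : (Pi.single i m : Fin 3 → ℕ) ≠ fun l => if l = i then 0 else 1 := by
      intro h
      have := congrFun h i
      simp at this
      omega
    -- This functional equals m on both ends of the first edge, but 1 on the end of the second edge
    -- off the j-th axis.
    have key := hc.le_of_exponentWeight_eq (v := Pi.single i 1 + Pi.single j (m : ℝ)) hu hμ hν hne
      (fun l => add_nonneg (single_apply_nonneg i zero_le_one l)
        (single_apply_nonneg j (Nat.cast_nonneg _) l))
      (by simp [exponentWeight_add, exponentWeight_single, Ne.symm hij]) hν'.1
    simp only [exponentWeight_add, exponentWeight_single, Pi.single_eq_same,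
      Pi.single_eq_of_ne (Ne.symm hij), if_neg hij, if_true] at key
    norm_cast at key
    omega

/-- There is an edge. -/
theorem exists_minimalExponents_ne {n : ℕ} [NeZero n] {S : Set (Fin n → ℕ)}
    (hS : IsIsolatedSupport S) : ∃ u : Fin n → ℝ, (∀ i, 0 < u i) ∧
      ∃ μ ∈ minimalExponents S u, ∃ ν ∈ minimalExponents S u, μ ≠ ν := by
  have hne : S.Nonempty := let ⟨ν, hν, _⟩ := hS.exists_plane 0; ⟨ν, hν⟩
  obtain ⟨μ, hμ⟩ := minimalExponents_nonempty (u := fun _ => 1) (fun _ => zero_lt_one) hne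
  obtain ⟨i, hi⟩ : ∃ i, μ i ≠ 0 := by
    by_contra! h
    have := hS.two_le_sum μ hμ.1
    simp [h] at this
  obtain ⟨ξ, hξ, hξi⟩ := hS.exists_plane i
  have hv : ∀ l, 0 ≤ (Pi.single i 1 : Fin n → ℝ) l := single_apply_nonneg i zero_le_one
  obtain ⟨s, hs, hμ', ζ, hζ, hlt⟩ := exists_mem_minimalExponents_add_smul (v := Pi.single i 1)
    (fun _ => zero_lt_one) hv hμ hξ (by
      simpa [exponentWeight_single, hξi] using Nat.pos_of_ne_zero hi)
  refine ⟨_, fun l => ?_, μ, hμ', ζ, hζ, ?_⟩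
  · simpa using add_pos_of_pos_of_nonneg one_pos (mul_nonneg hs (hv l))
  · rintro rfl
    exact hlt.ne rfl

end IsIsolatedSupport

/-! ### Compact faces of the Newton diagram. -/

/-- The Taylor support of `f`. -/
def taylorSupport {n : ℕ} (f : (Fin n → ℂ) → ℂ) : Set (Fin n → ℕ) := {ν | taylorCoeff f ν ≠ 0}

/-- An exponent as a point of `ℝⁿ`. -/
def exponentPoint {n : ℕ} (ν : Fin n → ℕ) : Fin n → ℝ := fun i => (ν i : ℝ)

theorem exponentPoint_injective {n : ℕ} :
    Function.Injective (exponentPoint : (Fin n → ℕ) → Fin n → ℝ) := fun _ _ h =>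
  funext fun i => Nat.cast_injective (congrFun h i)

theorem IsIsolatedSingularity.isIsolatedSupport {f : (Fin 3 → ℂ) → ℂ}
    (hf : IsIsolatedSingularity f) : IsIsolatedSupport (taylorSupport f) where
  two_le_sum _ hν := hf.toIsSingularity.two_le_sum hν
  exists_axis := hf.exists_nsmul_single_add_single
  exists_plane i := by
    obtain ⟨j, k, hij, hik, hjk⟩ : ∃ j k, i ≠ j ∧ i ≠ k ∧ j ≠ k := by
      revert i; decide
    exact hf.exists_taylorCoeff_ne_zero_apply_eq_zero hij hik hjk

section Faces

variable {n : ℕ} {f : (Fin n → ℂ) → ℂ} {u : Fin n → ℝ}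

theorem exponentPoint_mem_newtonDiagram {ν : Fin n → ℕ} (hν : ν ∈ taylorSupport f) :
    exponentPoint ν ∈ newtonDiagram f :=
  subset_convexHull ℝ _ ⟨ν, hν, fun _ => le_rfl⟩

/-- The face of the Newton diagram in a positive direction is spanned by the minimal exponents. -/
theorem supportFace_newtonDiagram (hu : ∀ i, 0 < u i) (hS : (taylorSupport f).Nonempty) :
    supportFace u (newtonDiagram f) =
      convexHull ℝ (exponentPoint '' minimalExponents (taylorSupport f) u) := by
  obtain ⟨μ, hμ⟩ := minimalExponents_nonempty hu hS
  set M := convexHull ℝ (exponentPoint '' minimalExponents (taylorSupport f) u) with hM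
  have hadd : ∀ (a b : ℝ) (x y : Fin n → ℝ), ∑ i, u i * (a • x + b • y) i =
      a * ∑ i, u i * x i + b * ∑ i, u i * y i := fun a b x y => by
    simp only [Pi.add_apply, Pi.smul_apply, smul_eq_mul, Finset.mul_sum,
      ← Finset.sum_add_distrib]
    exact Finset.sum_congr rfl fun i _ => by ring
  -- The lower bound and its equality case are proved together, since only their conjunction is
  -- stable under convex combinations.
  have hN : newtonDiagram f ⊆ {x | exponentWeight u μ ≤ ∑ i, u i * x i ∧
      (∑ i, u i * x i = exponentWeight u μ → x ∈ M)} := by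
    refine convexHull_min ?_ ?_
    · rintro x ⟨ν, hν, hle⟩
      have h1 : ∀ i ∈ Finset.univ, u i * (ν i : ℝ) ≤ u i * x i := fun i _ =>
        mul_le_mul_of_nonneg_left (hle i) (hu i).le
      have h2 : exponentWeight u ν ≤ ∑ i, u i * x i := Finset.sum_le_sum h1
      refine ⟨(hμ.2 ν hν).trans h2, fun heq => ?_⟩
      have h3 : exponentWeight u ν = ∑ i, u i * x i :=
        h2.antisymm (heq.trans_le (hμ.2 ν hν))
      have h4 : x = exponentPoint ν := funext fun i =>
        (mul_left_cancel₀ (hu i).ne'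
          ((Finset.sum_eq_sum_iff_of_le h1).1 h3 i (Finset.mem_univ i))).symm
      refine subset_convexHull ℝ _ ⟨ν, ⟨hν, fun ξ hξ => ?_⟩, h4.symm⟩
      rw [h3, heq]
      exact hμ.2 ξ hξ
    · refine convex_iff_forall_pos.2 ?_
      rintro x ⟨hx, hx'⟩ y ⟨hy, hy'⟩ a b ha hb hab
      have h1 := mul_le_mul_of_nonneg_left hx ha.le
      have h2 := mul_le_mul_of_nonneg_left hy hb.le
      have h3 : exponentWeight u μ = a * exponentWeight u μ + b * exponentWeight u μ := by
        rw [← add_mul, hab, one_mul]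
      refine ⟨by rw [hadd]; linarith, fun heq => ?_⟩
      rw [hadd] at heq
      refine convex_convexHull ℝ _ (hx' ?_) (hy' ?_) ha.le hb.le hab
      · exact mul_left_cancel₀ ha.ne' (by linarith)
      · exact mul_left_cancel₀ hb.ne' (by linarith)
  have hval : supportValue u (newtonDiagram f) = exponentWeight u μ := by
    refine IsLeast.csInf_eq ⟨⟨exponentPoint μ, exponentPoint_mem_newtonDiagram hμ.1, rfl⟩, ?_⟩
    rintro _ ⟨x, hx, rfl⟩
    exact (hN hx).1
  refine Set.Subset.antisymm ?_ ?_
  · rintro x ⟨hx, hxv⟩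
    exact (hN hx).2 (hxv.trans hval)
  · refine convexHull_min ?_ fun x ⟨hx, hxv⟩ y ⟨hy, hyv⟩ a b ha hb hab => ?_
    · rintro _ ⟨ν, hν, rfl⟩
      refine ⟨exponentPoint_mem_newtonDiagram hν.1, ?_⟩
      rw [hval]
      exact exponentWeight_eq_of_mem_minimalExponents hν hμ
    · refine ⟨convex_convexHull ℝ _ hx hy ha hb hab, ?_⟩
      rw [hadd, hxv, hyv, ← add_mul, hab, one_mul]

theorem supportFace_mem_newtonBoundary [NeZero n] (hu : ∀ i, 0 < u i)
    (hS : (taylorSupport f).Nonempty) :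
    supportFace u (newtonDiagram f) ∈ newtonBoundary f := by
  refine ⟨?_, u, fun i => (hu i).le, fun h => (hu 0).ne' (congrFun h 0), rfl⟩
  rw [supportFace_newtonDiagram hu hS]
  exact Set.Finite.isCompact_convexHull ℝ ((minimalExponents_finite hu _).image _)

theorem add_single_mem_newtonDiagram {x : Fin n → ℝ} (hx : x ∈ newtonDiagram f) (i : Fin n)
    {t : ℝ} (ht : 0 ≤ t) : x + Pi.single i t ∈ newtonDiagram f := by
  have h : newtonDiagram f ⊆ {x | x + Pi.single i t ∈ newtonDiagram f} := by
    refine convexHull_min ?_ ?_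
    · rintro y ⟨ν, hν, hle⟩
      refine subset_convexHull ℝ _ ⟨ν, hν, fun l => (hle l).trans ?_⟩
      simpa using single_apply_nonneg i ht l
    · exact (convex_convexHull ℝ _).translate_preimage_left _
  exact h hx

/-- The direction of a nonempty compact face is positive. -/
theorem pos_of_isCompact_supportFace (hu : ∀ i, 0 ≤ u i)
    (hc : IsCompact (supportFace u (newtonDiagram f)))
    (hne : (supportFace u (newtonDiagram f)).Nonempty) (i : Fin n) : 0 < u i := by
  refine (hu i).lt_of_ne' fun h0 => ?_
  obtain ⟨x, hx, hxv⟩ := hne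
  -- If u_i = 0, the face contains a ray in direction e_i and is unbounded.
  have hmem : ∀ t : ℝ, 0 ≤ t → x + Pi.single i t ∈ supportFace u (newtonDiagram f) := by
    intro t ht
    refine ⟨add_single_mem_newtonDiagram hx i ht, ?_⟩
    rw [← hxv]
    refine Finset.sum_congr rfl fun l _ => ?_
    by_cases hl : l = i
    · rw [hl, h0, zero_mul, zero_mul]
    · simp [hl]
  obtain ⟨C, hC⟩ := (hc.image (continuous_apply i)).bddAbove
  have h1 := hC ⟨_, hmem (|C| + |x i| + 1) (by positivity), rfl⟩
  simp only [Pi.add_apply, Pi.single_eq_same] at h1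
  have h2 := neg_abs_le (x i)
  have h3 := le_abs_self C
  linarith

theorem dotProduct_exponentPoint (v : Fin n → ℝ) (ν : Fin n → ℕ) :
    v ⬝ᵥ exponentPoint ν = exponentWeight v ν := rfl

theorem finrank_vectorSpan_segment {E : Type*} [AddCommGroup E] [Module ℝ E] {x y : E}
    (h : x ≠ y) : Module.finrank ℝ (vectorSpan ℝ (segment ℝ x y)) = 1 := by
  rw [← convexHull_pair, ← direction_affineSpan, affineSpan_convexHull, direction_affineSpan,
    vectorSpan_pair, finrank_span_singleton]
  simpa [sub_eq_zero] using h

end Faces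

/-- Three noncollinear exponents minimal for a positive weight give a compact two-dimensional
face. -/
theorem hasCollinearMinimalExponents_taylorSupport {f : (Fin 3 → ℂ) → ℂ}
    (h2 : newtonFaces f 2 = ∅) : HasCollinearMinimalExponents (taylorSupport f) := by
  intro u hu μ hμ ν hν hne ξ hξ v hv
  by_contra hvξ
  refine Set.eq_empty_iff_forall_notMem.1 h2 (supportFace u (newtonDiagram f))
    ⟨supportFace_mem_newtonBoundary hu ⟨μ, hμ.1⟩, ?_⟩
  rw [supportFace_newtonDiagram hu ⟨μ, hμ.1⟩, ← direction_affineSpan, affineSpan_convexHull,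
    direction_affineSpan]
  set V := vectorSpan ℝ (exponentPoint '' minimalExponents (taylorSupport f) u)
  refine le_antisymm ?_ ?_
  · have hle : V ≠ ⊤ := by
      intro htop
      -- u is constant on the minimal exponents, so V lies in a proper subspace and has dimension at
      -- most 2.
      have hker : V ≤ LinearMap.ker (dotProductBilin ℝ ℝ u) := by
        refine Submodule.span_le.2 ?_
        rintro _ ⟨_, ⟨a, ha, rfl⟩, _, ⟨b, hb, rfl⟩, rfl⟩
        simp [dotProduct_sub, dotProduct_exponentPoint,
          exponentWeight_eq_of_mem_minimalExponents ha hb]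
      have : (Pi.single 0 1 : Fin 3 → ℝ) ∈ V := htop ▸ Submodule.mem_top
      have := hker this
      simp at this
      exact (hu 0).ne' this
    have := Submodule.finrank_lt hle
    rw [Module.finrank_fin_fun] at this
    omega
  · have hli : LinearIndependent ℝ ![exponentPoint μ - exponentPoint ν,
        exponentPoint ξ - exponentPoint μ] := by
      rw [LinearIndependent.pair_iff]
      intro a b hab
      -- v vanishes on μ - ν but not on ξ - μ.
      have hb : b = 0 := by
        have := congrArg (v ⬝ᵥ ·) hab
        simp only [dotProduct_add, dotProduct_smul, dotProduct_sub, dotProduct_exponentPoint, hv,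
          sub_self, dotProduct_zero, smul_eq_mul, mul_zero, zero_add] at this
        rw [hv] at hvξ
        exact (mul_eq_zero.1 this).resolve_right (sub_ne_zero.2 hvξ)
      rw [hb, zero_smul, add_zero] at hab
      exact ⟨(smul_eq_zero.1 hab).resolve_right
        (sub_ne_zero.2 (exponentPoint_injective.ne hne)), hb⟩
    have hmem : ∀ i, (![exponentPoint μ - exponentPoint ν,
        exponentPoint ξ - exponentPoint μ] : Fin 2 → Fin 3 → ℝ) i ∈ V := by
      intro i
      fin_cases i
      · exact vsub_mem_vectorSpan ℝ ⟨μ, hμ, rfl⟩ ⟨ν, hν, rfl⟩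
      · exact vsub_mem_vectorSpan ℝ ⟨ξ, hξ, rfl⟩ ⟨μ, hμ, rfl⟩
    have hli' : LinearIndependent ℝ (fun i => (⟨_, hmem i⟩ : V)) :=
      LinearIndependent.of_comp V.subtype hli
    simpa using hli'.fintype_card_le_finrank

theorem proposition2 (f : (Fin 3 → ℂ) → ℂ) (hf : IsIsolatedSingularity f)
    (h2 : newtonFaces f 2 = ∅) :
    ∃ I ∈ segmentFamilyJ, newtonFaces f 1 = {I} := by
  have hS := hf.isIsolatedSupport
  have hc := hasCollinearMinimalExponents_taylorSupport h2
  have hne : (taylorSupport f).Nonempty := let ⟨ν, hν, _⟩ := hS.exists_plane 0; ⟨ν, hν⟩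
  have hedge : ∀ u : Fin 3 → ℝ, (∀ i, 0 < u i) → ∀ μ ∈ minimalExponents (taylorSupport f) u,
      ∀ ν ∈ minimalExponents (taylorSupport f) u, μ ≠ ν → ∃ (i : Fin 3) (m : ℕ), 2 ≤ m ∧
        Pi.single i m ∈ minimalExponents (taylorSupport f) u ∧
        (fun l => if l = i then 0 else 1) ∈ minimalExponents (taylorSupport f) u ∧
        ({μ, ν} : Set (Fin 3 → ℕ)) = {Pi.single i m, fun l => if l = i then 0 else 1} := by
    intro u hu μ hμ ν hν hμν
    obtain ⟨i, m, hm, ⟨rfl, rfl⟩ | ⟨rfl, rfl⟩⟩ := hS.exists_eq_single hc hu hμ hν hμν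
    · exact ⟨i, m, hm, hμ, hν, rfl⟩
    · exact ⟨i, m, hm, hν, hμ, Set.pair_comm _ _⟩
  obtain ⟨u, hu, μ, hμ, ν, hν, hμν⟩ := hS.exists_minimalExponents_ne
  obtain ⟨i, m, hm, hi, hi', -⟩ := hedge u hu μ hμ ν hν hμν
  have hne' : (Pi.single i m : Fin 3 → ℕ) ≠ fun l => if l = i then 0 else 1 := by
    intro h
    have := congrFun h i
    simp at this
    omega
  have hface : ∀ v : Fin 3 → ℝ, (∀ i, 0 < v i) →
      ∀ μ ∈ minimalExponents (taylorSupport f) v, ∀ ν ∈ minimalExponents (taylorSupport f) v,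
      μ ≠ ν → supportFace v (newtonDiagram f) =
        segment ℝ (fun l => if l = i then (0 : ℝ) else 1) (Pi.single i (m : ℝ)) := by
    intro v hv μ hμ ν hν hμν
    have hpair : ∀ μ ∈ minimalExponents (taylorSupport f) v,
        ∀ ν ∈ minimalExponents (taylorSupport f) v, μ ≠ ν →
        ({μ, ν} : Set (Fin 3 → ℕ)) = {Pi.single i m, fun l => if l = i then 0 else 1} := by
      intro μ hμ ν hν hμν
      obtain ⟨j, m', hm', hj, hj', heq⟩ := hedge v hv μ hμ ν hν hμν
      obtain ⟨rfl, rfl⟩ := IsIsolatedSupport.index_eq_and_eq hc hu hv hm hi hi' hj hj'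
      exact heq
    have hmin : minimalExponents (taylorSupport f) v =
        {Pi.single i m, fun l => if l = i then 0 else 1} := by
      -- Every pair of distinct minimal exponents is the same pair of ends, so pairing ξ with μ
      -- leaves no room for a third one.
      refine Set.Subset.antisymm (fun ξ hξ => ?_) ?_
      · by_cases hξμ : ξ = μ
        · rw [hξμ, ← hpair μ hμ ν hν hμν]
          exact Set.mem_insert _ _
        · rw [← hpair ξ hξ μ hμ hξμ]
          exact Set.mem_insert _ _
      · rw [← hpair μ hμ ν hν hμν]
        exact Set.pair_subset hμ hν
    rw [supportFace_newtonDiagram hv hne, hmin, Set.image_pair, convexHull_pair, segment_symm]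
    congr 1
    · funext l
      simp [exponentPoint]
    · funext l
      simp [exponentPoint, Pi.single_apply]
  have hu1 := hface u hu μ hμ ν hν hμν
  refine ⟨_, ⟨i, m, hm, rfl⟩, Set.eq_singleton_iff_unique_mem.2 ⟨⟨?_, ?_⟩, ?_⟩⟩
  · rw [← hu1]
    exact supportFace_mem_newtonBoundary hu hne
  · refine finrank_vectorSpan_segment fun h => ?_
    have := congrFun h i
    simp only [if_true, Pi.single_eq_same] at this
    norm_cast at this
    omega
  · rintro _ ⟨⟨hcomp, v, hv, -, rfl⟩, hdim⟩
    -- Dimension 1 gives two points in the face; compactness then makes v positive, and the face is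
    -- spanned by at least two minimal exponents.
    have hnt : (supportFace v (newtonDiagram f)).Nontrivial := by
      by_contra hsub
      rw [vectorSpan_of_subsingleton ℝ (Set.not_nontrivial_iff.1 hsub), finrank_bot] at hdim
      exact zero_ne_one hdim
    have hvpos := pos_of_isCompact_supportFace hv hcomp hnt.nonempty
    have hnt' : (minimalExponents (taylorSupport f) v).Nontrivial := by
      by_contra hsub
      rw [supportFace_newtonDiagram hvpos hne] at hnt
      refine Set.not_subsingleton_iff.2 hnt ?_
      obtain h | ⟨x, h⟩ :=
        ((Set.not_nontrivial_iff.1 hsub).image exponentPoint).eq_empty_or_singleton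
      · rw [h, convexHull_empty]
        exact Set.subsingleton_empty
      · rw [h, convexHull_singleton]
        exact Set.subsingleton_singleton
    obtain ⟨μ, hμ, ν, hν, hμν⟩ := hnt'
    exact hface v hvpos μ hμ ν hν hμν
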